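/- Let $\mathfrak M$ be a monster model, that is, a $\kappa$-saturated structure of a first-order (possibly many-sorted) language $L$, where $\kappa$ is an uncountable cardinal (for instance a saturated model of uncountable cardinality $\kappa$); sets of fewer than $\kappa$ elements are called small. Let $A\subseteq\mathfrak M$ be small, and let $x$ be a finite tuple of variables. A partial type over $A$ is a finitely satisfiable set of $L_A$-formulas; for such $p(x)$ let $p(\mathfrak M)$ be the set of its realizations in $\mathfrak M$. A subset of $p(\mathfrak M)$ is relatively ($B$-)definable if it is the intersection of $p(\mathfrak M)$ with a set definable in $\mathfrak M$ with parameters (from $B$), and similarly for binary relations on $p(\mathfrak M)$. A complete type $q(x)$ over $A$ is weakly o-minimal if there is a relatively $A$-definable linear order $<$ on $q(\mathfrak M)$ such that every relatively definable (with arbitrary parameters from $\mathfrak M$) subset of $q(\mathfrak M)$ has finitely many convex components (maximal convex subsets) in $(q(\mathfrak M),<)$. A partial type $p(x)$ over $A$ is dp-minimal if there do not exist an $L_A$-formula $\varphi(x,y)$ with $y$ a finite tuple of variables, an infinite $A$-indiscernible sequence $(b_i\mid i\in I)$ of tuples of the sorts of $y$ indexed by a linear order $I$, a realization $a$ of $p$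 in $\mathfrak M$, and $i_0<i_1<i_2<i_3$ in $I$ such that $\models\varphi(a,b_{i_0})\wedge\neg\varphi(a,b_{i_1})\wedge\varphi(a,b_{i_2})\wedge\neg\varphi(a,b_{i_3})$. A theory $T$ in a one-sorted language is weakly quasi-o-minimal if there is an $L$-formula $\theta(x,x')$ in two single variables such that, for every model $M$ of $T$, $M$ is infinite, $\theta$ defines a linear order $<$ on $M$, and every subset of $M$ that is definable with parameters is a Boolean combination of $\emptyset$-definable sets and $<$-convex sets. A one-sorted theory $T$ is dp-minimal if in every monster model of $T$ the partial type $x=x$ over $\emptyset$, with $x$ a single variable, is dp-minimal. Then the following hold. (1) If $p(x)$ is a partial type over a small set $A$ such that every complete type $q(x)$ over $A$ with $p\subseteq q$ is weakly o-minimal, then $p(x)$ is dp-minimal. (2) Every weakly o-minimal complete type $q(x)$ over a small set $A$ is dp-minimal. (3) Every weakly quasi-o-minimal theory is dp-minimal. -/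

import Mathlib

universe s u v w

/-! ### Many-sorted first-order logic -/

/-- A many-sorted first-order language: a type of sorts, function symbols with a tuple of argument
sorts and a value sort, and relation symbols with a tuple of argument sorts. A one-sorted language
is one whose type of sorts has exactly one element. -/
structure SortedLanguage where
  Sorts : Type s
  Functions : (n : ℕ) → (Fin n → Sorts) → Sorts → Type u
  Relations : (n : ℕ) → (Fin n → Sorts) → Type v

namespace SortedLanguage

/-- An `L`-structure: a carrier for each sort, and interpretations of the symbols. -/
structure Struct (L : SortedLanguage.{s, u, v}) where
  carrier : L.Sorts → Type w
  funMap : ∀ {n : ℕ} {τ : Fin n → L.Sorts} {t : L.Sorts},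
    L.Functions n τ t → (∀ i, carrier (τ i)) → carrier t
  relMap : ∀ {n : ℕ} {τ : Fin n → L.Sorts}, L.Relations n τ → (∀ i, carrier (τ i)) → Prop

/-- Terms in the variables `i : α`, the variable `i` being of sort `σ i`. -/
inductive Term (L : SortedLanguage.{s, u, v}) {α : Type w} (σ : α → L.Sorts) :
    L.Sorts → Type (max s u w)
  | var (i : α) : Term L σ (σ i)
  | func {n : ℕ} {τ : Fin n → L.Sorts} {t : L.Sorts} (f : L.Functions n τ t)
      (ts : ∀ i, Term L σ (τ i)) : Term L σ t

/-- The variables `σ` together with one new variable `none` of sort `t`. -/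
def extendSorts {L : SortedLanguage.{s, u, v}} {α : Type w} (σ : α → L.Sorts) (t : L.Sorts) :
    Option α → L.Sorts
  | none => t
  | some i => σ i

/-- First-order formulas whose free variables are among the `i : α`, the variable `i` being of
sort `σ i`; the quantifier `all t` binds the variable `none` of sort `t`. -/
inductive Formula (L : SortedLanguage.{s, u, v}) :
    {α : Type w} → (α → L.Sorts) → Type (max s u v (w + 1))
  | falsum {α : Type w} {σ : α → L.Sorts} : Formula L σ
  | equal {α : Type w} {σ : α → L.Sorts} {t : L.Sorts} (t₁ t₂ : Term L σ t) : Formula L σ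
  | rel {α : Type w} {σ : α → L.Sorts} {n : ℕ} {τ : Fin n → L.Sorts} (R : L.Relations n τ)
      (ts : ∀ i, Term L σ (τ i)) : Formula L σ
  | imp {α : Type w} {σ : α → L.Sorts} (φ ψ : Formula L σ) : Formula L σ
  | all {α : Type w} {σ : α → L.Sorts} (t : L.Sorts) (φ : Formula L (extendSorts σ t)) :
      Formula L σ

/-- Negation. -/
def Formula.not {L : SortedLanguage.{s, u, v}} {α : Type w} {σ : α → L.Sorts}
    (φ : Formula L σ) : Formula L σ :=
  Formula.imp φ Formula.falsum

universe w'

variable {L : SortedLanguage.{s, u, v}}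

/-- `M.Tuple σ` is the set of tuples of elements of `M` of sorts `σ`. -/
abbrev Struct.Tuple (M : Struct.{s, u, v, w} L) {α : Type w'} (σ : α → L.Sorts) :
    Type (max w w') :=
  ∀ i, M.carrier (σ i)

/-- The concatenation of two tuples. -/
def Struct.append (M : Struct.{s, u, v, w} L) {α β : Type*} {σ : α → L.Sorts} {τ : β → L.Sorts}
    (x : M.Tuple σ) (y : M.Tuple τ) : M.Tuple (Sum.elim σ τ)
  | Sum.inl i => x i
  | Sum.inr j => y j

/-- The tuple `x` extended by the value `a` of the new variable. -/
def Struct.extend (M : Struct.{s, u, v, w} L) {α : Type w'} {σ : α → L.Sorts} {t : L.Sorts}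
    (x : M.Tuple σ) (a : M.carrier t) : M.Tuple (extendSorts σ t)
  | none => a
  | some i => x i

/-- The value of a term. -/
def Term.realize (M : Struct.{s, u, v, w} L) {α : Type w'} {σ : α → L.Sorts}
    (x : M.Tuple σ) : {t : L.Sorts} → Term L σ t → M.carrier t
  | _, .var i => x i
  | _, .func f ts => M.funMap f (fun i => Term.realize M x (ts i))

/-- Truth of a formula at a tuple (Tarski's definition). -/
def Formula.Realize (M : Struct.{s, u, v, w} L) :
    {α : Type w'} → {σ : α → L.Sorts} → Formula L σ → M.Tuple σ → Prop
  | _, _, .falsum, _ => False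
  | _, _, .equal t₁ t₂, x => t₁.realize M x = t₂.realize M x
  | _, _, .rel R ts, x => M.relMap R (fun i => (ts i).realize M x)
  | _, _, .imp φ ψ, x => φ.Realize M x → ψ.Realize M x
  | _, _, .all t φ, x => ∀ a : M.carrier t, φ.Realize M (M.extend x a)

/-! ### Parameters, types, saturation -/

/-- The elements of `M`: the disjoint union of its sorts. -/
abbrev Struct.Elem (M : Struct.{s, u, v, w} L) : Type (max s w) :=
  Σ t : L.Sorts, M.carrier t

/-- The `L_A`-formulas in the variables `σ`: formulas in these variables and in the elements
of `A`, which stand for themselves. -/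
abbrev Struct.FormulaOver (M : Struct.{s, u, v, w} L) (A : Set M.Elem) {α : Type}
    (σ : α → L.Sorts) : Type (max s u v ((max s w) + 1)) :=
  Formula.{s, u, v, max s w} L (Sum.elim σ (fun a : A => a.1.1))

/-- Truth in `M` of an `L_A`-formula at a tuple, with the elements of `A` standing for
themselves. -/
def Struct.Holds (M : Struct.{s, u, v, w} L) {A : Set M.Elem} {α : Type} {σ : α → L.Sorts}
    (φ : M.FormulaOver A σ) (x : M.Tuple σ) : Prop :=
  φ.Realize M (M.append x (fun a : A => a.1.2))

/-- A set of tuples is `A`-definable if it is the solution set of an `L_A`-formula. -/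
def Struct.DefinableOver (M : Struct.{s, u, v, w} L) (A : Set M.Elem) {α : Type}
    {σ : α → L.Sorts} (D : Set (M.Tuple σ)) : Prop :=
  ∃ φ : M.FormulaOver A σ, D = {x | M.Holds φ x}

/-- The set of realizations in `M` of a set of `L_A`-formulas. -/
def Struct.realizations (M : Struct.{s, u, v, w} L) {A : Set M.Elem} {α : Type}
    {σ : α → L.Sorts} (p : Set (M.FormulaOver A σ)) : Set (M.Tuple σ) :=
  {x | ∀ φ ∈ p, M.Holds φ x}

/-- A partial type over `A`: a finitely satisfiable set of `L_A`-formulas. -/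
def Struct.IsPartialType (M : Struct.{s, u, v, w} L) {A : Set M.Elem} {α : Type}
    {σ : α → L.Sorts} (p : Set (M.FormulaOver A σ)) : Prop :=
  ∀ F : Set (M.FormulaOver A σ), F ⊆ p → F.Finite → (M.realizations F).Nonempty

/-- A complete type over `A`. -/
def Struct.IsCompleteType (M : Struct.{s, u, v, w} L) {A : Set M.Elem} {α : Type}
    {σ : α → L.Sorts} (q : Set (M.FormulaOver A σ)) : Prop :=
  M.IsPartialType q ∧ ∀ φ : M.FormulaOver A σ, φ ∈ q ∨ φ.not ∈ q

/-- `M` is `κ`-saturated: every partial type in finitely many variables over a set of fewer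
than `κ` elements is realized in `M`. -/
def Struct.IsSaturated (M : Struct.{s, u, v, w} L) (κ : Cardinal.{max s w}) : Prop :=
  ∀ A : Set M.Elem, Cardinal.mk A < κ → ∀ (α : Type) [Finite α] (σ : α → L.Sorts)
    (p : Set (M.FormulaOver A σ)), M.IsPartialType p → (M.realizations p).Nonempty

/-- `M` serves as a monster model, the small sets being those with fewer than `κ` elements, where
`κ` is uncountable. A saturated model of uncountable cardinality `κ` is of this kind, and so is
every finite structure (for every `κ`). -/
def Struct.IsMonster (M : Struct.{s, u, v, w} L) (κ : Cardinal.{max s w}) : Prop :=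
  Cardinal.aleph0 < κ ∧ M.IsSaturated κ

/-! ### Linear orders and convex components -/

/-- `r` restricts to a strict linear order on `P`. -/
def LinearOrderOn {X : Type*} (P : Set X) (r : X → X → Prop) : Prop :=
  (∀ x ∈ P, ¬ r x x) ∧
  (∀ x ∈ P, ∀ y ∈ P, ∀ z ∈ P, r x y → r y z → r x z) ∧
  (∀ x ∈ P, ∀ y ∈ P, r x y ∨ x = y ∨ r y x)

/-- `C` is a convex subset of `(P, r)`. -/
def ConvexIn {X : Type*} (P : Set X) (r : X → X → Prop) (C : Set X) : Prop :=
  C ⊆ P ∧ ∀ a ∈ C, ∀ b ∈ C, ∀ c ∈ P, r a c → r c b → c ∈ C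

/-- The convex components of `D` in `(P, r)`: the maximal convex subsets of `D`. -/
def convexComponents {X : Type*} (P : Set X) (r : X → X → Prop) (D : Set X) : Set (Set X) :=
  {C | Maximal (fun C' => C' ⊆ D ∧ ConvexIn P r C') C}

/-! ### Weakly o-minimal types -/

/-- The binary relation on tuples defined by an `L_A`-formula `θ(x, x')`. -/
def Struct.relOf (M : Struct.{s, u, v, w} L) {A : Set M.Elem} {α : Type} {σ : α → L.Sorts}
    (θ : M.FormulaOver A (Sum.elim σ σ)) (x y : M.Tuple σ) : Prop :=
  M.Holds θ (M.append x y)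

/-- The order `(P, r)` is weakly o-minimal: every subset of `P` which is relatively definable,
with arbitrary parameters from `M`, has finitely many convex components. -/
def Struct.WeaklyOMinimalOrder (M : Struct.{s, u, v, w} L) {α : Type} {σ : α → L.Sorts}
    (P : Set (M.Tuple σ)) (r : M.Tuple σ → M.Tuple σ → Prop) : Prop :=
  ∀ D : Set (M.Tuple σ), M.DefinableOver Set.univ D → (convexComponents P r (D ∩ P)).Finite

/-- The type `q` over `A` is weakly o-minimal: some relatively `A`-definable linear order on the
set of its realizations is weakly o-minimal. (Used for complete types `q`.) -/
def Struct.WeaklyOMinimalType (M : Struct.{s, u, v, w} L) {A : Set M.Elem} {α : Type}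
    {σ : α → L.Sorts} (q : Set (M.FormulaOver A σ)) : Prop :=
  ∃ θ : M.FormulaOver A (Sum.elim σ σ),
    LinearOrderOn (M.realizations q) (M.relOf θ) ∧
    M.WeaklyOMinimalOrder (M.realizations q) (M.relOf θ)

/-! ### dp-minimality -/

/-- The sequence of tuples `b` is `A`-indiscernible: increasing subsequences of the same finite
length satisfy the same `L_A`-formulas. -/
def Struct.Indiscernible (M : Struct.{s, u, v, w} L) (A : Set M.Elem) {β : Type}
    {τ : β → L.Sorts} {ι : Type*} [LinearOrder ι] (b : ι → M.Tuple τ) : Prop :=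
  ∀ (n : ℕ) (ψ : M.FormulaOver A (fun k : Fin n × β => τ k.2)) (i j : Fin n → ι),
    StrictMono i → StrictMono j →
      (M.Holds ψ (fun k => b (i k.1) k.2) ↔ M.Holds ψ (fun k => b (j k.1) k.2))

/-- The type `p` over `A` is dp-minimal: there are no `L_A`-formula `φ(x, y)`, infinite
`A`-indiscernible sequence `b` of tuples of the sorts of `y` and realization `a` of `p` such that
the truth value of `φ(a, y)` alternates at some four members of `b`. (Passing to a countable
subsequence, one may take the index set in `Type`.) -/
def Struct.DPMinimal (M : Struct.{s, u, v, w} L) {A : Set M.Elem} {α : Type}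
    {σ : α → L.Sorts} (p : Set (M.FormulaOver A σ)) : Prop :=
  ¬ ∃ (β : Type) (_ : Finite β) (τ : β → L.Sorts) (φ : M.FormulaOver A (Sum.elim σ τ))
      (ι : Type) (_ : LinearOrder ι) (_ : Infinite ι) (b : ι → M.Tuple τ) (a : M.Tuple σ)
      (i₀ i₁ i₂ i₃ : ι),
    M.Indiscernible A b ∧ a ∈ M.realizations p ∧ i₀ < i₁ ∧ i₁ < i₂ ∧ i₂ < i₃ ∧
    M.Holds φ (M.append a (b i₀)) ∧ ¬ M.Holds φ (M.append a (b i₁)) ∧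
    M.Holds φ (M.append a (b i₂)) ∧ ¬ M.Holds φ (M.append a (b i₃))

/-! ### Theories -/

/-- Sentences: formulas without free variables. -/
abbrev Sentence (L : SortedLanguage.{s, u, v}) : Type (max s u v 1) :=
  Formula.{s, u, v, 0} L (fun i : Empty => i.elim)

/-- `M` is a model of the theory `T`. -/
def Struct.Models (M : Struct.{s, u, v, w} L) (T : Set (Sentence L)) : Prop :=
  ∀ φ ∈ T, φ.Realize M (fun i => i.elim)

/-- A single variable of a one-sorted language. -/
def oneVar (L : SortedLanguage.{s, u, v}) [Unique L.Sorts] : Unit → L.Sorts := fun _ => default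

/-- The one-sorted structure `M` is weakly quasi-o-minimal with respect to the relation `<` that
is defined by the `L`-formula `θ(x, x')`: `M` is infinite, `<` is a linear order on `M`, and
every definable subset of `M` is a Boolean combination of `∅`-definable sets and convex sets. -/
def Struct.WeaklyQuasiOMinimal [Unique L.Sorts] (M : Struct.{s, u, v, w} L)
    (θ : Formula.{s, u, v, 0} L (Sum.elim (oneVar L) (oneVar L))) : Prop :=
  Infinite (M.Tuple (oneVar L)) ∧
  LinearOrderOn Set.univ (fun x y : M.Tuple (oneVar L) => θ.Realize M (M.append x y)) ∧
  ∀ D : Set (M.Tuple (oneVar L)), M.DefinableOver Set.univ D →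
    D ∈ BooleanSubalgebra.closure {C : Set (M.Tuple (oneVar L)) | M.DefinableOver ∅ C ∨
      ConvexIn Set.univ (fun x y : M.Tuple (oneVar L) => θ.Realize M (M.append x y)) C}

/-- The one-sorted theory `T` is weakly quasi-o-minimal: for some `L`-formula `θ(x, x')`, all
models of `T` are weakly quasi-o-minimal with respect to the order defined by `θ`. -/
def WeaklyQuasiOMinimalTheory [Unique L.Sorts] (T : Set (Sentence L)) : Prop :=
  ∃ θ : Formula.{s, u, v, 0} L (Sum.elim (oneVar L) (oneVar L)),
    ∀ M : Struct.{s, u, v, w} L, M.Models T → M.WeaklyQuasiOMinimal θ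

/-- The partial type `x = x` over `∅` in a single variable of a one-sorted language. -/
def Struct.trivialType [Unique L.Sorts] (M : Struct.{s, u, v, w} L) :
    Set (M.FormulaOver ∅ (oneVar L)) :=
  {Formula.equal (Term.var (Sum.inl ())) (Term.var (Sum.inl ()))}

/-- The one-sorted theory `T` is dp-minimal: the partial type `x = x` in a single variable is
dp-minimal (in monster models of `T`). -/
def DPMinimalTheory [Unique L.Sorts] (T : Set (Sentence L)) : Prop :=
  ∀ (M : Struct.{s, u, v, w} L) (κ : Cardinal.{max s w}), M.Models T → M.IsMonster κ →
    M.DPMinimal M.trivialType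

end SortedLanguage

/-! Let `q` be a type with a relatively definable linear order on its realizations, and let `D_b` be
the set that `φ(x, b)` cuts out there. Let `F_k(b)` be the set of realizations lying above an
alternating chain of length `k` for `D_b` (`AltBelow`). Three facts carry the proof.

Each `F_k(b)` is a final segment. When the lengths of alternating chains are bounded, the least `k`
with `x ∉ F_k(b)` decides by its parity whether `x ∈ D_b` (`mem_iff_of_altBelow_iff`). And `F_k(b)`
depends on `b` only through its type over `A`, in the sense that equality of types preserves
membership (`Struct.SameType.altBelow`).

If `φ(a, b_i)` alternates at `i₀ < i₁ < i₂ < i₃`, then some `F_k` separates `b_{i₀}` from `b_{i₁}`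
at `a`, and some `F_m` separates `b_{i₂}` from `b_{i₃}` at `a`. So `a` witnesses `F_k(b_i) ⊄
F_m(b_{j'})` for one pair taken from the two halves. By indiscernibility the noninclusion moves to
the opposite pair, where `a ∉ F_k(b_{i'})` and `a ∈ F_m(b_j)`. This is impossible, since it forces
`F_k(b_{i'}) ⊆ F_m(b_j)`: final segments form a chain.

The bound on chains holds for every `D` that is determined by finitely many final segments
(`FinDetermined`). This covers finite unions of convex sets and, on the realizations of a complete
type over `∅`, Boolean combinations of convex and `∅`-definable sets. -/

namespace SortedLanguage

universe w₁ w₂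

variable {L : SortedLanguage.{s, u, v}}

/-! ### Renaming variables, conjunctions and existential quantifiers -/

/-- Sorts of matching variables agree only propositionally, hence the heterogeneous equalities. The
two variable universes are independent, so that parameters, indexed in a larger universe, can be
added. -/
theorem Term.exists_rename (M : Struct.{s, u, v, w} L) {α : Type w₁} {α' : Type w₂}
    {σ : α → L.Sorts} {σ' : α' → L.Sorts} (f : α → α') (hf : ∀ i, σ' (f i) = σ i)
    {t : L.Sorts} (e : Term L σ t) :
    ∃ e' : Term L σ' t, ∀ (x : M.Tuple σ) (x' : M.Tuple σ'), (∀ i, HEq (x' (f i)) (x i)) →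
      e'.realize M x' = e.realize M x := by
  induction e with
  | var i =>
    -- With the target sort generalized, the equation between sorts can be eliminated.
    have key : ∀ t, σ' (f i) = t → ∃ e' : Term L σ' t, ∀ x' : M.Tuple σ',
        HEq (e'.realize M x') (x' (f i)) := by
      rintro _ rfl
      exact ⟨Term.var (f i), fun _ => HEq.rfl⟩
    obtain ⟨e', he'⟩ := key _ (hf i)
    exact ⟨e', fun x x' h => eq_of_heq ((he' x').trans (h i))⟩
  | func g ts ih =>
    choose ts' h using ih
    refine ⟨Term.func g ts', fun x x' hx => ?_⟩
    simp only [Term.realize]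
    congr 1
    funext i
    exact h i x x' hx

theorem Formula.exists_rename (M : Struct.{s, u, v, w} L) {α : Type w₁} {σ : α → L.Sorts}
    (φ : Formula L σ) : ∀ {α' : Type w₂} {σ' : α' → L.Sorts} (f : α → α'),
    (∀ i, σ' (f i) = σ i) →
    ∃ ψ : Formula L σ', ∀ (x : M.Tuple σ) (x' : M.Tuple σ'), (∀ i, HEq (x' (f i)) (x i)) →
      (ψ.Realize M x' ↔ φ.Realize M x) := by
  induction φ with
  | falsum => exact fun f hf => ⟨.falsum, fun x x' h => Iff.rfl⟩
  | equal t₁ t₂ =>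
    intro α' σ' f hf
    obtain ⟨e₁, h₁⟩ := Term.exists_rename M f hf t₁
    obtain ⟨e₂, h₂⟩ := Term.exists_rename M f hf t₂
    refine ⟨.equal e₁ e₂, fun x x' h => ?_⟩
    simp only [Formula.Realize, h₁ x x' h, h₂ x x' h]
  | rel R ts =>
    intro α' σ' f hf
    choose ts' h using fun i => Term.exists_rename M f hf (ts i)
    refine ⟨.rel R ts', fun x x' hx => ?_⟩
    simp only [Formula.Realize, h _ x x' hx]
  | imp φ ψ ihφ ihψ =>
    intro α' σ' f hf
    obtain ⟨φ', hφ⟩ := ihφ f hf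
    obtain ⟨ψ', hψ⟩ := ihψ f hf
    refine ⟨.imp φ' ψ', fun x x' h => ?_⟩
    simp only [Formula.Realize, hφ x x' h, hψ x x' h]
  | all t φ ih =>
    intro α' σ' f hf
    obtain ⟨φ', hφ⟩ := ih (σ' := extendSorts σ' t) (Option.map f)
      (by rintro (_ | i); exacts [rfl, hf i])
    refine ⟨.all t φ', fun x x' h => forall_congr' fun a => hφ _ _ ?_⟩
    rintro (_ | i)
    exacts [HEq.rfl, h i]

theorem Formula.exists_conj (M : Struct.{s, u, v, w} L) {α : Type w₁} {σ : α → L.Sorts}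
    {F : Set (Formula L σ)} (hF : F.Finite) :
    ∃ ψ : Formula L σ, ∀ x : M.Tuple σ, ψ.Realize M x ↔ ∀ φ ∈ F, φ.Realize M x := by
  induction F, hF using Set.Finite.induction_on with
  | empty => exact ⟨Formula.not .falsum, fun x => by simp [Formula.not, Formula.Realize]⟩
  | @insert φ F _ _ ih =>
    obtain ⟨ψ, hψ⟩ := ih
    refine ⟨(Formula.imp φ ψ.not).not, fun x => ?_⟩
    simp [Formula.not, Formula.Realize, hψ]

theorem Formula.exists_ex (M : Struct.{s, u, v, w} L) (β : Type) [Finite β] :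
    ∀ {α : Type w₁} {σ : α → L.Sorts} {τ : β → L.Sorts} (φ : Formula L (Sum.elim σ τ)),
    ∃ ψ : Formula L σ, ∀ x : M.Tuple σ,
      ψ.Realize M x ↔ ∃ y : M.Tuple τ, φ.Realize M (M.append x y) := by
  induction β using Finite.induction_empty_option with
  | @of_equiv β γ e ih =>
    intro α σ τ φ
    obtain ⟨φ', hφ'⟩ := φ.exists_rename M (σ' := Sum.elim σ (τ ∘ e))
      (Sum.map id e.symm) (by rintro (i | i) <;> simp)
    obtain ⟨ψ, hψ⟩ := ih φ'
    refine ⟨ψ, fun x => (hψ x).trans ⟨?_, ?_⟩⟩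
    · rintro ⟨y, hy⟩
      refine ⟨(Equiv.piCongrLeft (fun j => M.carrier (τ j)) e) y, (hφ' _ _ ?_).1 hy⟩
      rintro (i | i)
      · exact HEq.rfl
      · obtain ⟨i, rfl⟩ := e.surjective i
        simp only [Struct.append, Sum.map_inr, Equiv.piCongrLeft_apply_apply]
        rw [e.symm_apply_apply]
        exact HEq.rfl
    · rintro ⟨y, hy⟩
      refine ⟨fun i => y (e i), (hφ' _ _ ?_).2 hy⟩
      rintro (i | i)
      · exact HEq.rfl
      · obtain ⟨i, rfl⟩ := e.surjective i
        simp only [Struct.append, Sum.map_inr]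
        rw [e.symm_apply_apply]
        exact HEq.rfl
  | h_empty =>
    intro α σ τ φ
    obtain ⟨ψ, hψ⟩ := φ.exists_rename M (σ' := σ)
      (Sum.elim id (fun j : PEmpty => j.elim)) (by rintro (i | i); exacts [rfl, i.elim])
    have key : ∀ (x : M.Tuple σ) (y : M.Tuple τ),
        ψ.Realize M x ↔ φ.Realize M (M.append x y) := fun x y =>
      hψ _ _ (by rintro (i | i); exacts [HEq.rfl, i.elim])
    exact ⟨ψ, fun x => ⟨fun h => ⟨fun j => j.elim, (key _ _).1 h⟩,
      fun ⟨y, h⟩ => (key _ _).2 h⟩⟩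
  | @h_option β _ ih =>
    intro α σ τ φ
    obtain ⟨φ', hφ'⟩ := φ.exists_rename M
      (σ' := extendSorts (Sum.elim σ (fun j => τ (some j))) (τ none))
      (Sum.elim (fun i => some (Sum.inl i))
        (fun j => Option.casesOn j none (fun j => some (Sum.inr j))))
      (by rintro (i | (_ | i)) <;> rfl)
    obtain ⟨ψ, hψ⟩ := ih (Formula.all (τ none) φ'.not).not
    refine ⟨ψ, fun x => (hψ x).trans ?_⟩
    simp only [Formula.not, Formula.Realize, imp_false, not_forall, not_not]
    constructor
    · rintro ⟨y, c, h⟩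
      refine ⟨fun j => Option.casesOn j c y, (hφ' _ _ ?_).1 h⟩
      rintro (i | (_ | i)) <;> exact HEq.rfl
    · rintro ⟨y, h⟩
      refine ⟨fun j => y (some j), y none, (hφ' _ _ ?_).2 h⟩
      rintro (i | (_ | i)) <;> exact HEq.rfl

/-! ### Tuples of the same type, homogeneity -/

/-- The tuples `x` and `y` have the same complete type over `A`. -/
def Struct.SameType (M : Struct.{s, u, v, w} L) (A : Set M.Elem) {α : Type} {σ : α → L.Sorts}
    (x y : M.Tuple σ) : Prop :=
  ∀ φ : M.FormulaOver A σ, M.Holds φ x ↔ M.Holds φ y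

theorem Struct.exists_holds_rename (M : Struct.{s, u, v, w} L) {A : Set M.Elem} {α β : Type}
    {σ : α → L.Sorts} {τ : β → L.Sorts} (f : β → α) (hf : ∀ i, σ (f i) = τ i)
    (φ : M.FormulaOver A τ) : ∃ ψ : M.FormulaOver A σ, ∀ (x : M.Tuple τ) (x' : M.Tuple σ),
      (∀ i, HEq (x' (f i)) (x i)) → (M.Holds ψ x' ↔ M.Holds φ x) := by
  obtain ⟨ψ, hψ⟩ := φ.exists_rename M (σ' := Sum.elim σ (fun a : A => a.1.1)) (Sum.map f id)
    (by rintro (i | i); exacts [hf i, rfl])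
  exact ⟨ψ, fun x x' h => hψ _ _ (by rintro (i | i); exacts [h i, HEq.rfl])⟩

theorem Struct.SameType.holds_iff {M : Struct.{s, u, v, w} L} {A : Set M.Elem} {α β : Type}
    {σ : α → L.Sorts} {τ : β → L.Sorts} {x y : M.Tuple σ} (h : M.SameType A x y)
    (f : β → α) (hf : ∀ i, σ (f i) = τ i) {x' y' : M.Tuple τ} (hx : ∀ i, HEq (x (f i)) (x' i))
    (hy : ∀ i, HEq (y (f i)) (y' i)) (φ : M.FormulaOver A τ) :
    M.Holds φ x' ↔ M.Holds φ y' := by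
  obtain ⟨ψ, hψ⟩ := M.exists_holds_rename f hf φ
  rw [← hψ _ _ hx, ← hψ _ _ hy, h ψ]

/-- Formulas with some variables replaced by parameters. -/
theorem Struct.exists_holds_append (M : Struct.{s, u, v, w} L) {A B : Set M.Elem} {α β : Type}
    {σ : α → L.Sorts} {τ : β → L.Sorts} (y : M.Tuple τ) (hAB : A ⊆ B)
    (hy : ∀ j, (⟨τ j, y j⟩ : M.Elem) ∈ B) (φ : M.FormulaOver A (Sum.elim σ τ)) :
    ∃ ψ : M.FormulaOver B σ, ∀ x : M.Tuple σ, M.Holds ψ x ↔ M.Holds φ (M.append x y) := by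
  obtain ⟨ψ, hψ⟩ := φ.exists_rename M (σ' := Sum.elim σ (fun a : B => a.1.1))
    (Sum.elim (Sum.elim Sum.inl (fun j => Sum.inr ⟨⟨τ j, y j⟩, hy j⟩))
      (fun a => Sum.inr ⟨a.1, hAB a.2⟩)) (by rintro ((i | i) | i) <;> rfl)
  exact ⟨ψ, fun x => hψ _ _ (by rintro ((i | i) | i) <;> exact HEq.rfl)⟩

/-- Homogeneity of the monster: finitely many conditions on `y` over `x` amount to one existential
formula true of `x`, hence of `x'`; saturation over `A` and `x'` then realizes them all at once. -/
theorem Struct.IsMonster.exists_sameType_append {M : Struct.{s, u, v, w} L}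
    {κ : Cardinal.{max s w}} (hM : M.IsMonster κ) {A : Set M.Elem} (hA : Cardinal.mk A < κ)
    {α β : Type} [Finite α] [Finite β] {σ : α → L.Sorts} {τ : β → L.Sorts} {x x' : M.Tuple σ}
    (h : M.SameType A x x') (y : M.Tuple τ) :
    ∃ y' : M.Tuple τ, M.SameType A (M.append y x) (M.append y' x') := by
  set B : Set M.Elem := A ∪ Set.range (fun i => (⟨σ i, x' i⟩ : M.Elem)) with hB
  have hBκ : Cardinal.mk B < κ := by
    refine (Cardinal.mk_union_le _ _).trans_lt (Cardinal.add_lt_of_lt hM.1.le hA ?_)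
    exact (Cardinal.lt_aleph0_iff_set_finite.2 (Set.finite_range _)).trans hM.1
  choose g hg using fun φ : M.FormulaOver A (Sum.elim τ σ) =>
    M.exists_holds_append (B := B) x' Set.subset_union_left (fun j => Or.inr ⟨j, rfl⟩) φ
  obtain ⟨y', hy'⟩ := hM.2 B hBκ β τ (g '' {φ | M.Holds φ (M.append y x)}) (by
    intro F hF hfin
    obtain ⟨F₀, hF₀, hfin₀, rfl⟩ := Set.exists_subset_image_finite_and.1 ⟨F, hF, hfin, rfl⟩
    obtain ⟨χ, hχ⟩ := Formula.exists_conj M hfin₀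
    obtain ⟨χ', hχ'⟩ := χ.exists_rename M
      (σ' := Sum.elim (Sum.elim σ (fun a : A => a.1.1)) τ)
      (Sum.elim (Sum.elim Sum.inr (fun i => Sum.inl (Sum.inl i))) (fun a => Sum.inl (Sum.inr a)))
      (by rintro ((i | i) | i) <;> rfl)
    obtain ⟨ψ, hψ⟩ := Formula.exists_ex M β χ'
    have key : ∀ z : M.Tuple σ, M.Holds (A := A) ψ z ↔
        ∃ y : M.Tuple τ, ∀ φ ∈ F₀, M.Holds (A := A) φ (M.append y z) := by
      intro z
      refine (hψ _).trans (exists_congr fun y => (hχ' _ _ ?_).trans (hχ _))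
      rintro ((i | i) | i) <;> exact HEq.rfl
    obtain ⟨y', hy'⟩ := (key x').1 ((h ψ).1 ((key x).2 ⟨y, fun φ hφ => hF₀ hφ⟩))
    refine ⟨y', ?_⟩
    rintro _ ⟨φ, hφ, rfl⟩
    exact (hg φ y').2 (hy' φ hφ))
  have main : ∀ φ : M.FormulaOver A (Sum.elim τ σ), M.Holds φ (M.append y x) →
      M.Holds φ (M.append y' x') := fun φ hφ => (hg φ y').1 (hy' _ ⟨φ, hφ, rfl⟩)
  -- The type of `(y, x)` is complete, so one inclusion suffices: apply it to the negation.
  exact ⟨y', fun φ => ⟨main φ, fun h' => by_contra fun hn => main φ.not hn h'⟩⟩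

end SortedLanguage

/-! ### Alternations and final segments in linear orders -/

section Alternation

variable {X : Type*} {P : Set X} {r : X → X → Prop}

/-- There are `y₀ ≤ ⋯ ≤ yₖ₋₁ ≤ x` in `P` such that `yᵢ` is in `D` exactly for even `i`. -/
def AltBelow (P : Set X) (r : X → X → Prop) (D : Set X) : ℕ → X → Prop
  | 0, _ => True
  | k + 1, x => ∃ y ∈ P, ¬ r x y ∧ (y ∈ D ↔ Even k) ∧ AltBelow P r D k y

theorem LinearOrderOn.not_rel_trans (h : SortedLanguage.LinearOrderOn P r) {x y z : X}
    (hx : x ∈ P) (hy : y ∈ P) (hz : z ∈ P) (hyx : ¬ r y x) (hzy : ¬ r z y) : ¬ r z x := by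
  intro hzx
  rcases h.2.2 x hx y hy with hxy | rfl | hxy
  · exact hzy (h.2.1 z hz x hx y hy hzx hxy)
  · exact hzy hzx
  · exact hyx hxy

theorem AltBelow.mono (h : SortedLanguage.LinearOrderOn P r) {D : Set X} {k : ℕ} {x x' : X}
    (hx : x ∈ P) (hx' : x' ∈ P) (hxx' : ¬ r x' x) (hk : AltBelow P r D k x) :
    AltBelow P r D k x' := by
  cases k with
  | zero => trivial
  | succ k =>
    obtain ⟨y, hy, hxy, hD, hk⟩ := hk
    exact ⟨y, hy, LinearOrderOn.not_rel_trans h hy hx hx' hxy hxx', hD, hk⟩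

/-- If `N` is the greatest length of an alternating chain below `x`, then `x` cannot be appended to
such a chain, so its membership in `D` is opposite to that of the next term. -/
theorem mem_iff_of_altBelow_iff (h : SortedLanguage.LinearOrderOn P r) {D D' : Set X} {x : X}
    (hx : x ∈ P) {n : ℕ} (hn : ¬ AltBelow P r D n x)
    (hDD' : ∀ k, AltBelow P r D k x ↔ AltBelow P r D' k x) : x ∈ D ↔ x ∈ D' := by
  classical
  have hex : ∃ n, ¬ AltBelow P r D n x := ⟨n, hn⟩
  obtain ⟨N, hN⟩ : ∃ N, Nat.find hex = N + 1 := by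
    refine Nat.exists_eq_succ_of_ne_zero fun h0 => ?_
    have := Nat.find_spec hex
    rw [h0] at this
    exact this trivial
  have h₁ : ¬ AltBelow P r D (N + 1) x := hN ▸ Nat.find_spec hex
  have h₀ : AltBelow P r D N x := not_not.1 (Nat.find_min hex (by omega))
  have parity : ∀ E : Set X, ¬ AltBelow P r E (N + 1) x → AltBelow P r E N x →
      (x ∈ E ↔ ¬ Even N) := fun E h₁ h₀ => by
    have : ¬ (x ∈ E ↔ Even N) := fun he => h₁ ⟨x, hx, h.1 x hx, he, h₀⟩
    tauto
  rw [parity D h₁ h₀, parity D' (by rwa [← hDD']) (by rwa [← hDD'])]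

/-- On `P`, membership in `D` is determined by the membership in finitely many final segments
of `(P, r)`. -/
def FinDetermined (P : Set X) (r : X → X → Prop) (D : Set X) : Prop :=
  ∃ S : Set (Set X), S.Finite ∧ (∀ U ∈ S, ∀ x ∈ P, ∀ y ∈ P, x ∈ U → ¬ r y x → y ∈ U) ∧
    ∀ x ∈ P, ∀ y ∈ P, (∀ U ∈ S, x ∈ U ↔ y ∈ U) → (x ∈ D ↔ y ∈ D)

/-- Along an alternating chain, the family of final segments in `S` containing the current term
grows, and strictly so because membership in `D` changes. -/
theorem FinDetermined.exists_not_altBelow {D : Set X} (h : FinDetermined P r D) :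
    ∃ n, ∀ x, ¬ AltBelow P r D n x := by
  obtain ⟨S, hS, hfinal, hdet⟩ := h
  have hfin : ∀ x, {U ∈ S | x ∈ U}.Finite := fun x => hS.subset (Set.sep_subset _ _)
  have key : ∀ k, ∀ y ∈ P, (y ∈ D ↔ Even k) → AltBelow P r D k y →
      k ≤ {U ∈ S | y ∈ U}.ncard := by
    intro k
    induction k with
    | zero => exact fun _ _ _ _ => Nat.zero_le _
    | succ k ih =>
      rintro y hy hyD ⟨z, hz, hyz, hzD, hk⟩
      refine Nat.succ_le_of_lt ((ih z hz hzD hk).trans_lt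
        (Set.ncard_lt_ncard (Set.ssubset_iff_subset_ne.2 ⟨?_, fun heq => ?_⟩) (hfin y)))
      · exact fun U hU => ⟨hU.1, hfinal U hU.1 z hz y hy hU.2 hyz⟩
      · have := hdet z hz y hy fun U hU => by
          have := Set.ext_iff.1 heq U
          simpa [hU] using this
        rw [hzD, hyD, Nat.even_add_one] at this
        tauto
  refine ⟨S.ncard + 2, ?_⟩
  rintro x ⟨y, hy, -, hyD, hk⟩
  have := (key _ y hy hyD hk).trans (Set.ncard_le_ncard (Set.sep_subset _ _) hS)
  omega

/-! ### Sets determined by finitely many final segments -/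

theorem FinDetermined.of_constant {D : Set X} (h : ∀ x ∈ P, ∀ y ∈ P, x ∈ D → y ∈ D) :
    FinDetermined P r D :=
  ⟨∅, Set.finite_empty, by simp, fun x hx y hy _ => ⟨h x hx y hy, h y hy x hx⟩⟩

theorem FinDetermined.compl {D : Set X} (h : FinDetermined P r D) : FinDetermined P r Dᶜ := by
  obtain ⟨S, hS, hfinal, hdet⟩ := h
  exact ⟨S, hS, hfinal, fun x hx y hy hxy => not_congr (hdet x hx y hy hxy)⟩

theorem FinDetermined.sUnion {𝒟 : Set (Set X)} (hfin : 𝒟.Finite)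
    (h : ∀ D ∈ 𝒟, FinDetermined P r D) : FinDetermined P r (⋃₀ 𝒟) := by
  choose! S hS hfinal hdet using h
  refine ⟨⋃ D ∈ 𝒟, S D, hfin.biUnion hS, ?_, fun x hx y hy hxy => ?_⟩
  · simp only [Set.mem_iUnion]
    rintro U ⟨D, hD, hU⟩
    exact hfinal D hD U hU
  · refine exists_congr fun D => and_congr_right fun hD => hdet D hD x hx y hy fun U hU => ?_
    exact hxy U (Set.mem_biUnion hD hU)

theorem FinDetermined.union {D E : Set X} (hD : FinDetermined P r D)
    (hE : FinDetermined P r E) : FinDetermined P r (D ∪ E) := by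
  rw [← Set.sUnion_pair]
  exact FinDetermined.sUnion (Set.toFinite _) (by rintro _ (rfl | rfl) <;> assumption)

theorem FinDetermined.of_inter {D : Set X} (h : FinDetermined P r (D ∩ P)) :
    FinDetermined P r D := by
  obtain ⟨S, hS, hfinal, hdet⟩ := h
  refine ⟨S, hS, hfinal, fun x hx y hy hxy => ?_⟩
  simpa [hx, hy] using hdet x hx y hy hxy

/-- A convex set is a difference of two final segments: the points above some element of `C`, minus
the points strictly above all of `C`. -/
theorem FinDetermined.of_convexIn (h : SortedLanguage.LinearOrderOn P r) {C : Set X}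
    (hC : SortedLanguage.ConvexIn P r C) : FinDetermined P r C := by
  refine ⟨{{x | ∃ c ∈ C, ¬ r x c}, {x | ∀ c ∈ C, r c x}}, Set.toFinite _, ?_, ?_⟩
  · rintro U (rfl | rfl) x hx y hy hxU hyx
    · obtain ⟨c, hc, hxc⟩ := hxU
      exact ⟨c, hc, LinearOrderOn.not_rel_trans h (hC.1 hc) hx hy hxc hyx⟩
    · intro c hc
      rcases h.2.2 x hx y hy with hxy | rfl | hxy
      · exact h.2.1 c (hC.1 hc) x hx y hy (hxU c hc) hxy
      · exact hxU c hc
      · exact absurd hxy hyx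
  · have key : ∀ x ∈ P, x ∈ C ↔
        x ∈ {x | ∃ c ∈ C, ¬ r x c} ∧ x ∉ {x | ∀ c ∈ C, r c x} := by
      intro x hx
      refine ⟨fun hxC => ⟨⟨x, hxC, h.1 x hx⟩, fun hall => h.1 x hx (hall x hxC)⟩, ?_⟩
      rintro ⟨⟨c, hc, hxc⟩, hx'⟩
      simp only [Set.mem_ofPred_eq, not_forall] at hx'
      obtain ⟨d, hd, hdx⟩ := hx'
      rcases h.2.2 x hx c (hC.1 hc) with h' | rfl | hcx
      · exact absurd h' hxc
      · exact hc
      rcases h.2.2 x hx d (hC.1 hd) with hxd | rfl | h'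
      · exact hC.2 c hc d hd x hx hcx hxd
      · exact hd
      · exact absurd h' hdx
    intro x hx y hy hxy
    rw [key x hx, key y hy, hxy _ (Or.inl rfl), hxy _ (Or.inr rfl)]

theorem sUnion_convexComponents (h : SortedLanguage.LinearOrderOn P r) {D : Set X}
    (hD : D ⊆ P) : ⋃₀ SortedLanguage.convexComponents P r D = D := by
  refine Set.Subset.antisymm (Set.sUnion_subset fun C hC => hC.1.1) fun x hx => ?_
  have hx₀ : ({x} : Set X) ⊆ D ∧ SortedLanguage.ConvexIn P r {x} := by
    refine ⟨by simpa using hx, by simpa using hD hx, ?_⟩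
    rintro _ rfl _ rfl c hc h₁ h₂
    exact absurd (h.2.1 _ (hD hx) c hc _ (hD hx) h₁ h₂) (h.1 _ (hD hx))
  -- The component of `x` is the union of all convex subsets of `D` through `x`; any two of them
  -- overlap at `x`, which makes the union convex.
  set K := {C : Set X | (C ⊆ D ∧ SortedLanguage.ConvexIn P r C) ∧ x ∈ C} with hK
  have hxK : x ∈ ⋃₀ K := ⟨{x}, ⟨hx₀, rfl⟩, rfl⟩
  refine ⟨⋃₀ K, ⟨⟨Set.sUnion_subset fun C hC => hC.1.1, Set.sUnion_subset fun C hC => hC.1.2.1,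
    ?_⟩, fun C hC hKC => Set.subset_sUnion_of_mem ⟨hC, hKC hxK⟩⟩, hxK⟩
  rintro a ⟨C₁, hC₁, ha⟩ b ⟨C₂, hC₂, hb⟩ c hc hac hcb
  rcases h.2.2 c hc x (hD hx) with hcx | rfl | hxc
  · exact ⟨C₁, hC₁, hC₁.1.2.2 a ha x hC₁.2 c hc hac hcx⟩
  · exact hxK
  · exact ⟨C₂, hC₂, hC₂.1.2.2 x hC₂.2 b hb c hc hxc hcb⟩

theorem FinDetermined.of_finite_convexComponents (h : SortedLanguage.LinearOrderOn P r)
    {D : Set X} (hfin : (SortedLanguage.convexComponents P r (D ∩ P)).Finite) :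
    FinDetermined P r D := by
  refine FinDetermined.of_inter ?_
  rw [← sUnion_convexComponents h (Set.inter_subset_right : D ∩ P ⊆ P)]
  exact FinDetermined.sUnion hfin fun C hC => FinDetermined.of_convexIn h hC.1.2

end Alternation

namespace SortedLanguage

variable {L : SortedLanguage.{s, u, v}}

/-! ### dp-minimality -/

/-- The chain ranges over realizations of `q`, so its existence is not a single formula; instead
homogeneity carries the chain over one term at a time, from the top down. -/
theorem Struct.SameType.altBelow {M : Struct.{s, u, v, w} L} {κ : Cardinal.{max s w}}
    (hM : M.IsMonster κ) {A : Set M.Elem} (hA : Cardinal.mk A < κ) {α β : Type} [Finite α]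
    [Finite β] {σ : α → L.Sorts} {τ : β → L.Sorts} (q : Set (M.FormulaOver A σ))
    (θ : M.FormulaOver A (Sum.elim σ σ)) (φ : M.FormulaOver A (Sum.elim σ τ)) {k : ℕ} :
    ∀ {x x' : M.Tuple σ} {b b' : M.Tuple τ}, M.SameType A (M.append x b) (M.append x' b') →
      AltBelow (M.realizations q) (M.relOf θ) {z | M.Holds φ (M.append z b)} k x →
      AltBelow (M.realizations q) (M.relOf θ) {z | M.Holds φ (M.append z b')} k x' := by
  induction k with
  | zero => exact fun _ _ => trivial
  | succ k ih =>
    rintro x x' b b' h ⟨y, hy, hxy, hyD, hk⟩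
    obtain ⟨y', hyy'⟩ := hM.exists_sameType_append hA h y
    refine ⟨y', fun ψ hψ => ?_, ?_, ?_, ih (fun ψ => ?_) hk⟩
    · exact (hyy'.holds_iff (x' := y) Sum.inl (fun _ => rfl) (fun _ => HEq.rfl)
        (fun _ => HEq.rfl) ψ).1 (hy ψ hψ)
    · refine (not_congr (hyy'.holds_iff (Sum.elim (Sum.inr ∘ Sum.inl) Sum.inl)
        ?_ ?_ ?_ θ)).1 hxy <;> rintro (i | i) <;> rfl
    · refine (hyy'.holds_iff (Sum.elim Sum.inl (Sum.inr ∘ Sum.inr))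
        ?_ ?_ ?_ φ).symm.trans hyD <;> rintro (i | i) <;> rfl
    · refine hyy'.holds_iff (Sum.elim Sum.inl (Sum.inr ∘ Sum.inr))
        ?_ ?_ ?_ ψ <;> rintro (i | i) <;> rfl

theorem Struct.Indiscernible.sameType_pair {M : Struct.{s, u, v, w} L} {A : Set M.Elem}
    {β : Type} {τ : β → L.Sorts} {ι : Type*} [LinearOrder ι] {b : ι → M.Tuple τ}
    (h : M.Indiscernible A b) {i j i' j' : ι} (hij : i < j) (hij' : i' < j') :
    M.SameType A (M.append (b i) (b j)) (M.append (b i') (b j')) := by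
  intro φ
  obtain ⟨ψ, hψ⟩ := M.exists_holds_rename (σ := fun k : Fin 2 × β => τ k.2)
    (Sum.elim (fun k => (0, k)) (fun k => (1, k))) (by rintro (k | k) <;> rfl) φ
  have mono : ∀ {i j : ι}, i < j → StrictMono ![i, j] := fun hij => by
    rw [Fin.strictMono_iff_lt_succ]
    simpa using hij
  have key : ∀ i j : ι, M.Holds ψ (fun k => b (![i, j] k.1) k.2) ↔
      M.Holds φ (M.append (b i) (b j)) :=
    fun i j => hψ _ _ (by rintro (k | k) <;> exact HEq.rfl)
  rw [← key, ← key]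
  exact h 2 ψ _ _ (mono hij) (mono hij')

theorem Struct.dpMinimal_of_finDetermined {M : Struct.{s, u, v, w} L} {κ : Cardinal.{max s w}}
    (hM : M.IsMonster κ) {A : Set M.Elem} (hA : Cardinal.mk A < κ) {α : Type} [Finite α]
    {σ : α → L.Sorts} (q : Set (M.FormulaOver A σ)) (θ : M.FormulaOver A (Sum.elim σ σ))
    (hθ : LinearOrderOn (M.realizations q) (M.relOf θ))
    (hq : ∀ D : Set (M.Tuple σ), M.DefinableOver Set.univ D →
      FinDetermined (M.realizations q) (M.relOf θ) D) : M.DPMinimal q := by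
  rintro ⟨β, _, τ, φ, ι, _, -, b, a, i₀, i₁, i₂, i₃, hb, ha, h₀₁, h₁₂, h₂₃, h₀, h₁, h₂, h₃⟩
  set F : ℕ → ι → M.Tuple σ → Prop := fun k i =>
    AltBelow (M.realizations q) (M.relOf θ) {z | M.Holds φ (M.append z (b i))} k with hF
  have cross : ∀ i j, M.Holds φ (M.append a (b i)) → ¬ M.Holds φ (M.append a (b j)) →
      ∃ k, ¬ (F k i a ↔ F k j a) := by
    intro i j hi hj
    by_contra! hcon
    -- The set cut out by `φ(x, b_i)` is definable with parameters, so its alternating chains are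
    -- bounded.
    obtain ⟨ψ, hψ⟩ := M.exists_holds_append (B := Set.univ) (b i) (Set.subset_univ _)
      (fun _ => trivial) φ
    obtain ⟨n, hn⟩ := (hq {z | M.Holds φ (M.append z (b i))}
      ⟨ψ, by simp only [hψ]⟩).exists_not_altBelow
    exact hj ((mem_iff_of_altBelow_iff hθ ha (hn a) hcon).1 hi)
  have transfer : ∀ {k m : ℕ} {i j i' j' : ι}, i < j → i' < j' →
      (∃ x ∈ M.realizations q, F k i x ∧ ¬ F m j x) →
      ∃ x ∈ M.realizations q, F k i' x ∧ ¬ F m j' x := by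
    rintro k m i j i' j' hij hij' ⟨x, hx, hk, hm⟩
    obtain ⟨x', hxx'⟩ := hM.exists_sameType_append hA (hb.sameType_pair hij hij') x
    have hi : M.SameType A (M.append x (b i)) (M.append x' (b i')) := fun ψ => by
      refine hxx'.holds_iff (Sum.elim Sum.inl (Sum.inr ∘ Sum.inl))
        ?_ ?_ ?_ ψ <;> rintro (i | i) <;> rfl
    have hj : M.SameType A (M.append x' (b j')) (M.append x (b j)) := fun ψ => by
      symm
      refine hxx'.holds_iff (Sum.elim Sum.inl (Sum.inr ∘ Sum.inr))
        ?_ ?_ ?_ ψ <;> rintro (i | i) <;> rfl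
    refine ⟨x', fun ψ hψ => ?_, hi.altBelow hM hA q θ φ hk,
      fun hm' => hm (hj.altBelow hM hA q θ φ hm')⟩
    exact (hxx'.holds_iff (x' := x) Sum.inl (fun _ => rfl) (fun _ => HEq.rfl)
      (fun _ => HEq.rfl) ψ).1 (hx ψ hψ)
  obtain ⟨k, hk⟩ := cross i₀ i₁ h₀ h₁
  obtain ⟨m, hm⟩ := cross i₂ i₃ h₂ h₃
  -- The direction of each separation is unknown; the argument only needs both indices of the first
  -- pair to lie below both indices of the second.
  obtain ⟨i, i', hi, hi', hki, hki'⟩ :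
      ∃ i i', i < i₂ ∧ i' < i₂ ∧ F k i a ∧ ¬ F k i' a := by
    have := h₀₁.trans h₁₂
    by_cases hc : F k i₀ a
    · exact ⟨i₀, i₁, this, h₁₂, hc, by tauto⟩
    · exact ⟨i₁, i₀, h₁₂, this, by tauto, hc⟩
  obtain ⟨j, j', hj, hj', hmj, hmj'⟩ :
      ∃ j j', i₂ ≤ j ∧ i₂ ≤ j' ∧ F m j a ∧ ¬ F m j' a := by
    by_cases hc : F m i₂ a
    · exact ⟨i₂, i₃, le_rfl, h₂₃.le, hc, by tauto⟩
    · exact ⟨i₃, i₂, h₂₃.le, le_rfl, by tauto, hc⟩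
  obtain ⟨x, hx, hkx, hmx⟩ :=
    transfer (hi.trans_le hj') (hi'.trans_le hj) ⟨a, ha, hki, hmj'⟩
  -- Compare `a` with `x ∈ F_k(b_{i'}) \ F_m(b_j)`: above `a`, `x` would inherit membership in
  -- `F_m(b_j)`; otherwise `a` would inherit membership in `F_k(b_{i'})`.
  by_cases hax : M.relOf θ a x
  · exact hmx (AltBelow.mono hθ ha hx
      (fun hxa => hθ.1 a ha (hθ.2.1 a ha x hx a ha hax hxa)) hmj)
  · exact hki' (AltBelow.mono hθ hx ha hax hkx)

theorem Struct.WeaklyOMinimalType.dpMinimal {M : Struct.{s, u, v, w} L}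
    {κ : Cardinal.{max s w}} (hM : M.IsMonster κ) {A : Set M.Elem} (hA : Cardinal.mk A < κ)
    {α : Type} [Finite α] {σ : α → L.Sorts} {q : Set (M.FormulaOver A σ)}
    (hq : M.WeaklyOMinimalType q) : M.DPMinimal q := by
  obtain ⟨θ, hθ, hfin⟩ := hq
  exact M.dpMinimal_of_finDetermined hM hA q θ hθ fun D hD =>
    FinDetermined.of_finite_convexComponents hθ (hfin D hD)

/-- The complete type of a tuple over `A`. -/
def Struct.typeOver (M : Struct.{s, u, v, w} L) (A : Set M.Elem) {α : Type} {σ : α → L.Sorts}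
    (a : M.Tuple σ) : Set (M.FormulaOver A σ) :=
  {φ | M.Holds φ a}

theorem Struct.mem_realizations_typeOver (M : Struct.{s, u, v, w} L) (A : Set M.Elem) {α : Type}
    {σ : α → L.Sorts} (a : M.Tuple σ) : a ∈ M.realizations (M.typeOver A a) :=
  fun _ hφ => hφ

theorem Struct.isCompleteType_typeOver (M : Struct.{s, u, v, w} L) (A : Set M.Elem) {α : Type}
    {σ : α → L.Sorts} (a : M.Tuple σ) : M.IsCompleteType (M.typeOver A a) :=
  ⟨fun _ hF _ => ⟨a, fun _ hφ => hF hφ⟩, fun φ => Classical.em (M.Holds φ a)⟩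

/-- A failure of dp-minimality involves a single realization `a`, hence already occurs for the
complete type of `a`. -/
theorem Struct.DPMinimal.of_typeOver {M : Struct.{s, u, v, w} L} {A : Set M.Elem} {α : Type}
    {σ : α → L.Sorts} {p : Set (M.FormulaOver A σ)}
    (h : ∀ a ∈ M.realizations p, M.DPMinimal (M.typeOver A a)) : M.DPMinimal p := by
  rintro ⟨β, hβ, τ, φ, ι, hι, hinf, b, a, i₀, i₁, i₂, i₃, hb, ha, hrest⟩
  exact h a ha ⟨β, hβ, τ, φ, ι, hι, hinf, b, a, i₀, i₁, i₂, i₃, hb,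
    M.mem_realizations_typeOver A a, hrest⟩

/-- On the realizations of a complete type over `∅`, an `∅`-definable set is everything or nothing
and a convex set remains convex, so every definable set is determined there by finitely many final
segments. -/
theorem Struct.WeaklyQuasiOMinimal.dpMinimal [Unique L.Sorts] {M : Struct.{s, u, v, w} L}
    {κ : Cardinal.{max s w}} (hM : M.IsMonster κ)
    {θ : Formula.{s, u, v, 0} L (Sum.elim (oneVar L) (oneVar L))}
    (h : M.WeaklyQuasiOMinimal θ) (p : Set (M.FormulaOver ∅ (oneVar L))) :
    M.DPMinimal p := by
  obtain ⟨-, hlin, hdef⟩ := h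
  obtain ⟨θ', hθ'⟩ := θ.exists_rename M
    (σ' := Sum.elim (Sum.elim (oneVar L) (oneVar L)) (fun a : (∅ : Set M.Elem) => a.1.1))
    Sum.inl (fun _ => rfl)
  have hrel : M.relOf (A := ∅) θ' = fun x y => θ.Realize M (M.append x y) := by
    funext x y
    exact propext (hθ' _ _ fun _ => HEq.rfl)
  refine Struct.DPMinimal.of_typeOver fun a _ => ?_
  have hP : LinearOrderOn (M.realizations (M.typeOver ∅ a)) (M.relOf (A := ∅) θ') := by
    rw [hrel]
    exact ⟨fun x _ => hlin.1 x trivial, fun x _ y _ z _ => hlin.2.1 x trivial y trivial z trivial,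
      fun x _ y _ => hlin.2.2 x trivial y trivial⟩
  refine M.dpMinimal_of_finDetermined hM
    (by simpa using Cardinal.aleph0_pos.trans hM.1) _ θ' hP fun D hD => ?_
  replace hD := hdef D hD
  induction hD using BooleanSubalgebra.closure_bot_sup_induction with
  | mem C hC =>
    rcases hC with ⟨ψ, rfl⟩ | hC
    · refine FinDetermined.of_constant fun x hx y hy hxψ => ?_
      by_contra hyψ
      rcases Classical.em (M.Holds ψ a) with hψ | hψ
      · exact hyψ (hy ψ hψ)
      · exact hx ψ.not hψ hxψ
    · refine FinDetermined.of_inter (FinDetermined.of_convexIn hP ⟨Set.inter_subset_right, ?_⟩)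
      rw [hrel]
      exact fun x hx y hy z hz hxz hzy => ⟨hC.2 x hx.1 y hy.1 z trivial hxz hzy, hz⟩
  | bot => exact FinDetermined.of_constant fun _ _ _ _ h => h.elim
  | sup C _ E _ hC hE => exact hC.union hE
  | compl C _ hC => exact hC.compl

end SortedLanguage

theorem mainTheorem8 :
    (∀ (L : SortedLanguage.{s, u, v}) (M : SortedLanguage.Struct.{s, u, v, w} L)
      (κ : Cardinal.{max s w}), M.IsMonster κ →
      ∀ A : Set M.Elem, Cardinal.mk A < κ →
      ∀ (α : Type) [Finite α] (σ : α → L.Sorts),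
        (∀ p : Set (M.FormulaOver A σ), M.IsPartialType p →
          (∀ q : Set (M.FormulaOver A σ), M.IsCompleteType q → p ⊆ q →
            M.WeaklyOMinimalType q) →
          M.DPMinimal p) ∧
        (∀ q : Set (M.FormulaOver A σ), M.IsCompleteType q → M.WeaklyOMinimalType q →
          M.DPMinimal q)) ∧
    (∀ (L : SortedLanguage.{s, u, v}) [Unique L.Sorts] (T : Set (SortedLanguage.Sentence L)),
      SortedLanguage.WeaklyQuasiOMinimalTheory.{s, u, v, w} T →
      SortedLanguage.DPMinimalTheory.{s, u, v, w} T) := by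
  refine ⟨fun L M κ hM A hA α _ σ => ⟨fun p _ hp => ?_, fun q _ hq => hq.dpMinimal hM hA⟩, ?_⟩
  · refine SortedLanguage.Struct.DPMinimal.of_typeOver fun a ha => ?_
    exact (hp _ (M.isCompleteType_typeOver A a) fun φ hφ => ha φ hφ).dpMinimal hM hA
  · rintro L _ T ⟨θ, hθ⟩ M κ hMT hM
    exact (hθ M hMT).dpMinimal hM _
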